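/- Let $1\le D<2$, let $S\in\{1/2,1,3/2,\dots\}$, and let $C_0,J^{\rm XY}_{\max},J^{\rm Z}_{\max}$ and $\Delta E$ be positive constants. Let $\Lambda^{(N)}=(\Lambda_s^{(N)},\Lambda_b^{(N)})$, $N=0,1,2,\dots$, be finite connected graphs (sites and bonds) with $|\Lambda_s^{(N)}|\to\infty$ as $N\to\infty$. Let ${\rm dist}$ denote the graph distance, and assume that in every $\Lambda^{(N)}$ all the spheres satisfy $$|\{\ell\in\Lambda_s^{(N)}:{\rm dist}(\ell,m)=r\}|\le C_0\,r^{D-1}\qquad (m\in\Lambda_s^{(N)},\ r\ge 1).$$ On $\bigotimes_{i\in\Lambda_s^{(N)}}\mathbb C^{2S+1}$, with $(S_i^x,S_i^y,S_i^z)$ the spin-$S$ operators at the site $i$, consider the XXZ Hamiltonian $$H_{\Lambda}=2\sum_{\{i,j\}\in\Lambda_b}J^{\rm XY}_{i,j}(S_i^xS_j^x+S_i^yS_j^y)+\sum_{\{i,j\}\in\Lambda_b}J^{\rm Z}_{i,j}S_i^zS_j^z,\qquad \Lambda=\Lambda^{(N)},$$ where the real couplings may depend on $N$ and satisfy $|J^{\rm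 XY}_{i,j}|\le J^{\rm XY}_{\max}$ and $|J^{\rm Z}_{i,j}|\le J^{\rm Z}_{\max}$ on all bonds. Assume that there is a uniform gap above the sector of the ground state: for every $N$ there is a nonempty set $\Gamma_N$ of eigenvalues of $H_{\Lambda^{(N)}}$ at the bottom of its spectrum (every element of $\Gamma_N$ is smaller than every element of $\sigma(H_{\Lambda^{(N)}})\setminus\Gamma_N$), such that the distance between any element of $\Gamma_N$ and any element of $\sigma(H_{\Lambda^{(N)}})\setminus\Gamma_N$ is larger than $\Delta E$, and such that $\max_{E,E'\in\Gamma_N}|E-E'|\to 0$ as $N\to\infty$. Let $P_0$ be the orthogonal projection onto the span of the eigenvectors with eigenvalues in $\Gamma_N$, let $q$ be its rank (which may depend on $N$ and be unbounded), and put $\langle A\rangle_0=\frac1q{\rm Tr}(A P_0)$ and $S_i^\pm=S_i^x\pm iS_i^y$. Then there are constants $\gamma>0$ and $C>0$, independent of $N$ and of the sites, such that in the thermodynamic limit $$\left|\langle S_m^+S_n^-\rangle_0\right|\le C\exp\left[-\gamma\,\{{\rm dist}(m,n)\}^{1-D/2}\right];$$ precisely: for every $R\ge 0$ there is an $N_0$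 such that the bound holds for all $N\ge N_0$ and all the sites $m,n\in\Lambda_s^{(N)}$ with ${\rm dist}(m,n)\le R$. -/

import Mathlib

open Filter Topology

noncomputable section

namespace XXZ

/-! Single-site spin operators. The spin is `S = k / 2` with `k ≥ 1`; the basis vector with index
`a : Fin (k + 1)` is the eigenvector of `S^z` with eigenvalue `S - a`. -/

/-- `S^z`. -/
def spinZ (k : ℕ) : Matrix (Fin (k + 1)) (Fin (k + 1)) ℂ :=
  Matrix.diagonal fun a => (k : ℂ) / 2 - (a : ℕ)

/-- `S^+`. For the eigenvalue `μ = S - b` of `S^z`, the usual matrix element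
`√(S (S + 1) - μ (μ + 1))` from `μ` to `μ + 1` is `√(b (k + 1 - b))`. -/
def spinPlus (k : ℕ) : Matrix (Fin (k + 1)) (Fin (k + 1)) ℂ :=
  fun a b => if (a : ℕ) + 1 = (b : ℕ) then
    ((Real.sqrt (((b : ℕ) : ℝ) * ((k : ℝ) + 1 - ((b : ℕ) : ℝ))) : ℝ) : ℂ) else 0

/-- `S^-`, the adjoint of `S^+`. -/
def spinMinus (k : ℕ) : Matrix (Fin (k + 1)) (Fin (k + 1)) ℂ :=
  (spinPlus k).conjTranspose

/-- `S^x`. -/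
def spinX (k : ℕ) : Matrix (Fin (k + 1)) (Fin (k + 1)) ℂ :=
  (1 / 2 : ℂ) • (spinPlus k + spinMinus k)

/-- `S^y`. -/
def spinY (k : ℕ) : Matrix (Fin (k + 1)) (Fin (k + 1)) ℂ :=
  (1 / (2 * Complex.I) : ℂ) • (spinPlus k - spinMinus k)

theorem spinPlus_eq (k : ℕ) : spinPlus k = spinX k + Complex.I • spinY k := by
  ext a b
  simp only [spinX, spinY, Matrix.add_apply, Matrix.smul_apply, Matrix.sub_apply, smul_eq_mul]
  field_simp
  ring

theorem spinMinus_eq (k : ℕ) : spinMinus k = spinX k - Complex.I • spinY k := by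
  ext a b
  simp only [spinX, spinY, Matrix.add_apply, Matrix.smul_apply, Matrix.sub_apply, smul_eq_mul]
  field_simp
  ring

/-! The many-spin system. The Hilbert space `⨂_{i ∈ V} ℂ^{k+1}` is `ℂ^(V → Fin (k + 1))`, whose
standard basis is the product basis of the `S^z` eigenvectors. -/

/-- Indices of the product basis. -/
abbrev Config (V : Type*) (k : ℕ) : Type _ := V → Fin (k + 1)

section Lattice

variable {V : Type*} [Fintype V] [DecidableEq V]

/-- The single-site operator `A` acting at the site `i`, i.e. `A` at `i` tensored with the
identity at all the other sites. -/
def onSite {k : ℕ} (i : V) (A : Matrix (Fin (k + 1)) (Fin (k + 1)) ℂ) :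
    Matrix (Config V k) (Config V k) ℂ :=
  fun σ τ => if ∀ j, j ≠ i → σ j = τ j then A (σ i) (τ i) else 0

open Classical in
/-- The sum `∑_{{i,j}} f i j` over the bonds of the graph, for `f` symmetric in the two sites:
the sum over ordered pairs of adjacent sites meets every bond twice. -/
def bondSum {M : Type*} [AddCommMonoid M] [Module ℂ M] (G : SimpleGraph V) (f : V → V → M) : M :=
  (1 / 2 : ℂ) • ∑ i : V, ∑ j : V, if G.Adj i j then f i j else 0

/-- `H^{XY} = 2 ∑_{{i,j}} J^{XY}_{i,j} (S_i^x S_j^x + S_i^y S_j^y)`. -/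
def hamiltonianXY (k : ℕ) (G : SimpleGraph V) (JXY : Sym2 V → ℝ) :
    Matrix (Config V k) (Config V k) ℂ :=
  (2 : ℂ) • bondSum G fun i j => ((JXY s(i, j) : ℝ) : ℂ) •
    (onSite i (spinX k) * onSite j (spinX k) + onSite i (spinY k) * onSite j (spinY k))

/-- `V = ∑_{{i,j}} J^Z_{i,j} S_i^z S_j^z`. -/
def potentialZ (k : ℕ) (G : SimpleGraph V) (JZ : Sym2 V → ℝ) :
    Matrix (Config V k) (Config V k) ℂ :=
  bondSum G fun i j => ((JZ s(i, j) : ℝ) : ℂ) • (onSite i (spinZ k) * onSite j (spinZ k))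

/-- The XXZ Hamiltonian `H = H^{XY} + V` of the spin `k / 2` on the graph `G`. -/
def hamiltonian (k : ℕ) (G : SimpleGraph V) (JXY JZ : Sym2 V → ℝ) :
    Matrix (Config V k) (Config V k) ℂ :=
  hamiltonianXY k G JXY + potentialZ k G JZ

/-- `|S_r(m)| ≤ C₀ r^(D-1)` for all the sites `m` and the radii `r ≥ 1`, where `S_r(m)` is the
sphere of radius `r` about `m` in the graph distance. -/
def SphereBound (G : SimpleGraph V) (D C₀ : ℝ) : Prop :=
  ∀ (m : V) (r : ℕ), 1 ≤ r → (Set.ncard {l : V | G.dist l m = r} : ℝ) ≤ C₀ * (r : ℝ) ^ (D - 1)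

end Lattice

/-! Sectors of the ground state. -/

section Sector

variable {ι : Type*} [Fintype ι] [DecidableEq ι]

/-- `Γ` is a nonempty set of eigenvalues at the bottom of the spectrum of `H`, and the rest of
the spectrum (if any) lies above `Γ`, at a distance larger than `ΔE`. -/
structure IsGroundSector (H : Matrix ι ι ℂ) (Γ : Set ℝ) (ΔE : ℝ) : Prop where
  nonempty : Γ.Nonempty
  subset_spectrum : Γ ⊆ spectrum ℝ H
  bottom : ∀ E ∈ Γ, ∀ E' ∈ spectrum ℝ H \ Γ, E < E'
  gap : ∀ E ∈ Γ, ∀ E' ∈ spectrum ℝ H \ Γ, ΔE < |E' - E|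

/-- The span of all the eigenvectors of `H` with eigenvalues in `Γ`. -/
def sectorSpace (H : Matrix ι ι ℂ) (Γ : Set ℝ) : Submodule ℂ (EuclideanSpace ℂ ι) :=
  ⨆ E ∈ Γ, Module.End.eigenspace (Matrix.toEuclideanLin H) ((E : ℝ) : ℂ)

/-- The expectation `⟨A⟩₀ = (1/q) Tr (A P₀)`, where `P₀` is the orthogonal projection onto the
sector and `q` is the number of its eigenvalues, counted with multiplicity. -/
def groundExpectation (H : Matrix ι ι ℂ) (Γ : Set ℝ) (A : Matrix ι ι ℂ) : ℂ :=
  (1 / (Module.finrank ℂ (sectorSpace H Γ) : ℂ)) *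
    LinearMap.trace ℂ (EuclideanSpace ℂ ι)
      (Matrix.toEuclideanLin A ∘ₗ ((sectorSpace H Γ).starProjection : _ →ₗ[ℂ] _))

end Sector

/-- A uniform gap above the sector of the ground state for a sequence of Hamiltonians: the sectors
`Γ N` are separated from the rest of the spectrum by a gap `ΔE > 0` that does not depend on `N`,
and the energy spread `max |E - E'|` over `E, E' ∈ Γ N` tends to zero. -/
structure HasUniformGap {ι : ℕ → Type*} [∀ N, Fintype (ι N)] [∀ N, DecidableEq (ι N)]
    (H : ∀ N, Matrix (ι N) (ι N) ℂ) (Γ : ℕ → Set ℝ) (ΔE : ℝ) : Prop where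
  pos : 0 < ΔE
  sector : ∀ N, IsGroundSector (H N) (Γ N) ΔE
  spread : Tendsto (fun N => Metric.diam (Γ N)) atTop (𝓝 0)

end XXZ

end

/-! The proof conjugates by an imaginary-angle rotation about the z axis, `g = exp (∑ α j • S_j^z)`,
where `α` is a cone of slope `η` and radius `r = dist(m,n)` centred at `n`. Conjugation multiplies
`S_m^+ S_n^-` by `t = exp (α m - α n) = exp (-η r)`. In `g H g⁻¹` the longitudinal terms are fixed,
and the Hermitian part of each transverse bond term gains only a factor `cosh (α i - α j)`. Since
`O(r^D)` bonds are affected, the Hermitian part of `H` moves by `O(r^D η²)`. The choice `η = κ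
r^(-D/2)` with small `κ` keeps this well below the gap, while `η r = κ r^(1-D/2)`.

The shift of `H` that is of first order in `η` is anti-Hermitian and invisible in the real part of a
quadratic form. Hence `g` and `g⁻¹` send the sector to vectors of low energy, which by the gap lie
close to the sector (`norm_sub_starProjection_le`). This forces the oblique projection `Q = g P₀
g⁻¹` to have norm at most 3, however large `‖g‖` is (`norm_oblique_projection_le`).

By cyclicity `Tr (A P₀) = t Tr (A Q)`, and `|Tr (A Q)| ≤ 3 ‖A‖ q` because `Q` has rank `q`. The
degeneracy therefore cancels in `⟨A⟩₀`. The size of `g` enters only through `‖g‖ ‖g⁻¹‖` times the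
energy spread of the sector, which for bounded `r` vanishes as `N → ∞`. -/

namespace XXZ

/-! ### Norm and trace bounds for an oblique projection -/

section ObliqueProjection

variable {E : Type*} [NormedAddCommGroup E] [InnerProductSpace ℂ E]

/-- The Pythagorean bound for a vector within relative distance `1/2` of a subspace. -/
theorem norm_starProjection_sq_ge (U : Submodule ℂ E) [U.HasOrthogonalProjection] (u : E)
    (h : ‖u - U.starProjection u‖ ≤ 1 / 2 * ‖u‖) :
    3 / 4 * ‖u‖ ^ 2 ≤ ‖U.starProjection u‖ ^ 2 := by
  have h1 : ‖u‖ ^ 2 = ‖U.starProjection u‖ ^ 2 + ‖u - U.starProjection u‖ ^ 2 := by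
    have := norm_add_sq_eq_norm_sq_add_norm_sq_of_inner_eq_zero (𝕜 := ℂ) (U.starProjection u)
      (u - U.starProjection u) (Submodule.inner_right_of_mem_orthogonal
        (U.starProjection_apply_mem u) (U.sub_starProjection_mem_orthogonal u))
    simpa [sq] using this
  have h2 : ‖u - U.starProjection u‖ ^ 2 ≤ (1 / 2 * ‖u‖) ^ 2 := by gcongr
  nlinarith

theorem inner_eq_inner_starProjection_add (U : Submodule ℂ E) [U.HasOrthogonalProjection]
    (y u : E) :
    inner ℂ y u = inner ℂ (U.starProjection y) (U.starProjection u) +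
      inner ℂ (y - U.starProjection y) (u - U.starProjection u) := by
  have h1 : inner ℂ (U.starProjection y) (u - U.starProjection u) = 0 :=
    Submodule.inner_right_of_mem_orthogonal
      (U.starProjection_apply_mem y) (U.sub_starProjection_mem_orthogonal u)
  have h2 : inner ℂ (y - U.starProjection y) (U.starProjection u) = 0 :=
    Submodule.inner_left_of_mem_orthogonal
      (U.starProjection_apply_mem u) (U.sub_starProjection_mem_orthogonal y)
  simp only [inner_sub_left, inner_sub_right] at h1 h2 ⊢
  linear_combination h1 + h2

variable [FiniteDimensional ℂ E]

/-- If `g` and `g' = g⁻¹` map the subspace `U` into vectors that are close to `U`, then the oblique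
projection `g P g'` is bounded by an absolute constant. -/
theorem norm_oblique_projection_le (U : Submodule ℂ E) (g g' : E →ₗ[ℂ] E)
    (hg' : g'.IsSymmetric) (hg'g : ∀ v, g' (g v) = v) (hgg' : ∀ v, g (g' v) = v)
    (h : ∀ v ∈ U, ‖g v - U.starProjection (g v)‖ ≤ 1 / 2 * ‖g v‖)
    (h' : ∀ v ∈ U, ‖g' v - U.starProjection (g' v)‖ ≤ 1 / 2 * ‖g' v‖) (w : E) :
    ‖g (U.starProjection (g' w))‖ ≤ 3 * ‖w‖ := by
  set u := g (U.starProjection (g' w)) with hu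
  -- The test vector `g' v` is to have the same projection as `u`. It exists because the compression
  -- of `g'` to `U` is injective: if `P (g' v) = 0`, then `h'` gives `‖g' v‖ ≤ ‖g' v‖ / 2`. In
  -- finite dimension it is then onto.
  obtain ⟨v, hvU, hv⟩ : ∃ v ∈ U, U.starProjection (g' v) = U.starProjection u := by
    let T : U →ₗ[ℂ] U := (U.orthogonalProjectionOnto : E →ₗ[ℂ] U) ∘ₗ g' ∘ₗ U.subtype
    have hT : ∀ v : U, ((T v : U) : E) = U.starProjection (g' v) := fun v => rfl
    have hinj : Function.Injective T := by
      rw [← LinearMap.ker_eq_bot, LinearMap.ker_eq_bot']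
      intro v hv
      have h0 : U.starProjection (g' v) = 0 := by rw [← hT, hv]; rfl
      have h1 := h' v v.2
      rw [h0, sub_zero] at h1
      have h2 : g' v = 0 := by
        rw [← norm_eq_zero]
        linarith [norm_nonneg (g' (v : E))]
      have h3 := hgg' v
      rw [h2, map_zero] at h3
      exact Subtype.ext h3.symm
    obtain ⟨v, hv⟩ := LinearMap.surjective_of_injective hinj (U.orthogonalProjectionOnto u)
    exact ⟨v, v.2, by rw [← hT, hv]; rfl⟩
  have hP : ∀ x ∈ U, U.starProjection x = x := fun x hx =>
    Submodule.starProjection_eq_self_iff.2 hx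
  -- Both sides equal `⟨v, P g' w⟩`, since `g' u = P g' w` and `v ∈ U`.
  have hin : inner ℂ (g' v) w = inner ℂ (g' v) u := by
    rw [hg', hg' v u, hu, hg'g, ← U.inner_starProjection_left_eq_right, hP v hvU]
  have hu1 := h _ (U.starProjection_apply_mem (g' w))
  rw [← hu] at hu1
  have hu2 := norm_starProjection_sq_ge U u hu1
  have hy1 := h' v hvU
  have hy2 := norm_starProjection_sq_ge U _ hy1
  have hPu := U.norm_starProjection_apply_le u
  rw [hv] at hy2
  -- The projections agree, so `‖g' v‖² ≤ (4/3) ‖u‖²`, and `4/3 < (7/6)²`.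
  have hy3 : ‖g' v‖ ≤ 7 / 6 * ‖u‖ := by
    apply le_of_sq_le_sq _ (by positivity)
    have : ‖U.starProjection u‖ ^ 2 ≤ ‖u‖ ^ 2 := by gcongr
    nlinarith
  have hkey : ‖U.starProjection u‖ ^ 2 ≤ ‖g' v‖ * ‖w‖ +
      ‖g' v - U.starProjection (g' v)‖ * ‖u - U.starProjection u‖ := by
    have h1 := inner_eq_inner_starProjection_add U (g' v) u
    rw [← hin, hv, inner_self_eq_norm_sq_to_K] at h1
    have h2 : ((‖U.starProjection u‖ : ℂ)) ^ 2 = inner ℂ (g' v) w -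
        inner ℂ (g' v - U.starProjection (g' v)) (u - U.starProjection u) := by
      rw [h1, hv]; simp
    have h3 : ‖U.starProjection u‖ ^ 2 = ‖((‖U.starProjection u‖ : ℂ)) ^ 2‖ := by
      simp
    rw [h3, h2]
    refine (norm_sub_le _ _).trans (add_le_add (norm_inner_le_norm _ _) (norm_inner_le_norm _ _))
  rcases (norm_nonneg u).eq_or_lt with h0 | h0
  · rw [← h0]; positivity
  have e1 : ‖g' v‖ * ‖w‖ ≤ 7 / 6 * ‖u‖ * ‖w‖ := by gcongr
  have e2 : ‖g' v - U.starProjection (g' v)‖ * ‖u - U.starProjection u‖ ≤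
      (1 / 2 * (7 / 6 * ‖u‖)) * (1 / 2 * ‖u‖) := by gcongr; linarith
  -- `11/24 = 3/4 - 7/24`; the resulting constant is `28/11 < 3`.
  have e3 : ‖u‖ * (11 / 24 * ‖u‖) ≤ ‖u‖ * (7 / 6 * ‖w‖) := by nlinarith
  have e4 := le_of_mul_le_mul_left e3 h0
  linarith [norm_nonneg w]

/-- The trace of a bounded operator against a bounded oblique projection is at most of the order of
the rank. -/
theorem norm_trace_comp_oblique_projection_le (U : Submodule ℂ E) (g g' : E →ₗ[ℂ] E)
    (hg'g : ∀ v, g' (g v) = v) {c : ℝ} (hc : 0 ≤ c)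
    (hQ : ∀ w, ‖g (U.starProjection (g' w))‖ ≤ c * ‖w‖) (A : E →ₗ[ℂ] E) {a : ℝ}
    (hA : ∀ w, ‖A w‖ ≤ a * ‖w‖) :
    ‖LinearMap.trace ℂ E (A ∘ₗ g ∘ₗ (U.starProjection : E →ₗ[ℂ] E) ∘ₗ g')‖ ≤
      c * a * Module.finrank ℂ U := by
  set W := U.map g with hW
  set Q : E →ₗ[ℂ] E := g ∘ₗ (U.starProjection : E →ₗ[ℂ] E) ∘ₗ g' with hQdef
  have hdim : Module.finrank ℂ W = Module.finrank ℂ U :=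
    (LinearEquiv.finrank_eq (U.equivMapOfInjective g
      (Function.LeftInverse.injective hg'g))).symm
  have hQW : ∀ w, Q w ∈ W := fun w =>
    Submodule.mem_map_of_mem (U.starProjection_apply_mem (g' w))
  -- Factoring `Q` through its range moves the trace to a space of dimension `finrank U`, where it
  -- is a sum of that many bounded matrix elements.
  have h1 : A ∘ₗ Q = (A ∘ₗ W.subtype) ∘ₗ (Q.codRestrict W hQW) := by ext; rfl
  rw [h1, LinearMap.trace_comp_comm', LinearMap.trace_eq_sum_inner _ (stdOrthonormalBasis ℂ W),
    ← hdim]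
  refine (norm_sum_le_of_le (f := _) _ (n := fun _ => c * a) fun i _ => ?_).trans ?_
  · set b := stdOrthonormalBasis ℂ W i with hb
    have hb1 : ‖b‖ = 1 := (stdOrthonormalBasis ℂ W).norm_eq_one i
    refine (norm_inner_le_norm _ _).trans ?_
    rw [hb1, one_mul]
    have h3 : ‖Q (A b)‖ ≤ c * ‖A b‖ := hQ _
    have h4 := hA b
    rw [Submodule.norm_coe, hb1, mul_one] at h4
    exact h3.trans (by gcongr)
  · simp [mul_comm]

end ObliqueProjection

/-! ### Energy of rotated low-energy vectors -/

section EnergyEstimate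

variable {E : Type*} [NormedAddCommGroup E] [InnerProductSpace ℂ E] [FiniteDimensional ℂ E]

/-- The energy estimate: the image under `g` of a low-energy vector is again of low energy, because
the first-order part of `g H g⁻¹ - H` is anti-Hermitian. -/
theorem norm_sub_starProjection_le (U : Submodule ℂ E) (H g g' : E →ₗ[ℂ] E)
    (hH : H.IsSymmetric) (hg : g.IsSymmetric) (hg' : g'.IsSymmetric)
    (hg'g : ∀ v, g' (g v) = v) {E₀ Δ δ a b b' : ℝ} (hΔ : 0 < Δ) (hδ : 0 ≤ δ) (hb : 0 ≤ b)
    (hU : ∀ v ∈ U, ‖H v - (E₀ : ℂ) • v‖ ≤ δ * ‖v‖)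
    (hgap : ∀ w, Δ * ‖w - U.starProjection w‖ ^ 2 ≤ (inner ℂ w (H w - (E₀ : ℂ) • w)).re)
    (hgb : ∀ w, ‖g w‖ ≤ b * ‖w‖) (hgb' : ∀ w, ‖g' w‖ ≤ b' * ‖w‖)
    (hA : ∀ w, ‖(1 / 2 : ℂ) • (g (H (g' w)) + g' (H (g w))) - H w‖ ≤ a * ‖w‖)
    (hsmall : a + b * b' * δ ≤ Δ / 4) :
    ∀ v ∈ U, ‖g v - U.starProjection (g v)‖ ≤ 1 / 2 * ‖g v‖ := by
  intro v hv
  set u := g v with hu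
  have hv' : v = g' u := (hg'g v).symm
  -- `g H g'` and `g' H g` are adjoint to each other, so `g H g'` may be replaced by its Hermitian
  -- part in real parts.
  have e1 : (inner ℂ u (g (H (g' u)))).re = (inner ℂ u (g' (H (g u)))).re := by
    rw [← hg, ← hH, ← hg', ← inner_conj_symm, Complex.conj_re]
  have e2 : (inner ℂ u (H u - (E₀ : ℂ) • u)).re =
      (inner ℂ u (g (H v - (E₀ : ℂ) • v))).re -
        (inner ℂ u ((1 / 2 : ℂ) • (g (H (g' u)) + g' (H (g u))) - H u)).re := by
    rw [map_sub, map_smul, ← hu]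
    rw [show H v = H (g' u) by rw [← hv']]
    simp only [inner_sub_right, inner_smul_right, inner_add_right, Complex.sub_re, Complex.mul_re,
      Complex.add_re]
    rw [e1]
    norm_num
    ring
  have e3 : (inner ℂ u (g (H v - (E₀ : ℂ) • v))).re ≤ b * b' * δ * ‖u‖ ^ 2 := by
    refine (Complex.re_le_norm _).trans ((norm_inner_le_norm _ _).trans ?_)
    have : ‖g (H v - (E₀ : ℂ) • v)‖ ≤ b * (δ * (b' * ‖u‖)) := by
      refine (hgb _).trans ?_
      gcongr
      refine (hU v hv).trans ?_
      gcongr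
      nth_rewrite 1 [hv']
      exact hgb' u
    calc ‖u‖ * ‖g (H v - (E₀ : ℂ) • v)‖ ≤ ‖u‖ * (b * (δ * (b' * ‖u‖))) := by gcongr
      _ = _ := by ring
  have e4 : -(inner ℂ u ((1 / 2 : ℂ) • (g (H (g' u)) + g' (H (g u))) - H u)).re ≤ a * ‖u‖ ^ 2 := by
    refine (neg_le_abs _).trans ((Complex.abs_re_le_norm _).trans
      ((norm_inner_le_norm _ _).trans ?_))
    calc ‖u‖ * _ ≤ ‖u‖ * (a * ‖u‖) := by gcongr; exact hA u
      _ = _ := by ring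
  have e5 := hgap u
  -- The budget `Δ / 4` is `Δ (1/2)²`, which yields the relative distance `1/2`.
  have e6 : Δ * ‖u - U.starProjection u‖ ^ 2 ≤ Δ * (1 / 2 * ‖u‖) ^ 2 := by
    have : (a + b * b' * δ) * ‖u‖ ^ 2 ≤ Δ / 4 * ‖u‖ ^ 2 := by gcongr
    nlinarith
  exact le_of_sq_le_sq (le_of_mul_le_mul_left e6 hΔ) (by positivity)

end EnergyEstimate

/-! ### The sector in an eigenvector basis -/

section SpectralSector

variable {ι : Type*} [Fintype ι] [DecidableEq ι] {H : Matrix ι ι ℂ} {Γ : Set ℝ} {ΔE : ℝ}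

theorem toEuclideanLin_eigenvectorBasis (hH : H.IsHermitian) (i : ι) :
    Matrix.toEuclideanLin H (hH.eigenvectorBasis i) =
      (hH.eigenvalues i : ℂ) • hH.eigenvectorBasis i := by
  rw [Matrix.toLpLin_apply, hH.mulVec_eigenvectorBasis]
  ext j
  simp

theorem eigenvectorBasis_mem_sectorSpace (hH : H.IsHermitian) {i : ι}
    (hi : hH.eigenvalues i ∈ Γ) : hH.eigenvectorBasis i ∈ sectorSpace H Γ :=
  Submodule.mem_iSup_of_mem _ (Submodule.mem_iSup_of_mem hi
    (Module.End.mem_eigenspace_iff.2 (toEuclideanLin_eigenvectorBasis hH i)))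

theorem isSymmetric_toEuclideanLin (hH : H.IsHermitian) :
    (Matrix.toEuclideanLin H).IsSymmetric :=
  Matrix.isSymmetric_toEuclideanLin_iff.2 hH

theorem inner_eigenvectorBasis_apply (hH : H.IsHermitian) (i : ι) (w : EuclideanSpace ℂ ι) :
    inner ℂ (hH.eigenvectorBasis i) (Matrix.toEuclideanLin H w) =
      (hH.eigenvalues i : ℂ) * inner ℂ (hH.eigenvectorBasis i) w := by
  rw [← isSymmetric_toEuclideanLin hH, toEuclideanLin_eigenvectorBasis, inner_smul_left,
    Complex.conj_ofReal]

theorem inner_eigenvectorBasis_eq_zero (hH : H.IsHermitian) {i : ι}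
    (hi : hH.eigenvalues i ∉ Γ) {v : EuclideanSpace ℂ ι} (hv : v ∈ sectorSpace H Γ) :
    inner ℂ (hH.eigenvectorBasis i) v = 0 := by
  have hle : sectorSpace H Γ ≤ (ℂ ∙ hH.eigenvectorBasis i)ᗮ := by
    refine iSup₂_le fun E hE w hw => ?_
    rw [Submodule.mem_orthogonal_singleton_iff_inner_right]
    have h1 := inner_eigenvectorBasis_apply hH i w
    rw [Module.End.mem_eigenspace_iff.1 hw, inner_smul_right] at h1
    have hne : (E : ℂ) - hH.eigenvalues i ≠ 0 := by
      intro h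
      apply hi
      have : E = hH.eigenvalues i := by exact_mod_cast sub_eq_zero.1 h
      rwa [← this]
    apply (mul_eq_zero.1 (_ : ((E : ℂ) - hH.eigenvalues i) * _ = 0)).resolve_left hne
    linear_combination h1
  exact Submodule.mem_orthogonal_singleton_iff_inner_right.1 (hle hv)

theorem inner_eigenvectorBasis_sub_smul (hH : H.IsHermitian) (i : ι) (E₀ : ℝ)
    (w : EuclideanSpace ℂ ι) :
    inner ℂ (hH.eigenvectorBasis i) (Matrix.toEuclideanLin H w - (E₀ : ℂ) • w) =
      ((hH.eigenvalues i - E₀ : ℝ) : ℂ) * inner ℂ (hH.eigenvectorBasis i) w := by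
  rw [inner_sub_right, inner_eigenvectorBasis_apply, inner_smul_right]
  push_cast
  ring

theorem IsGroundSector.isBounded (hs : IsGroundSector H Γ ΔE) : Bornology.IsBounded Γ :=
  (H.finite_real_spectrum.subset hs.subset_spectrum).isBounded

/-- On the sector, `H` deviates from a ground-state energy by at most the energy spread. -/
theorem IsGroundSector.norm_apply_sub_le (hs : IsGroundSector H Γ ΔE) (hH : H.IsHermitian)
    {E₀ : ℝ} (hE₀ : E₀ ∈ Γ) {v : EuclideanSpace ℂ ι} (hv : v ∈ sectorSpace H Γ) :
    ‖Matrix.toEuclideanLin H v - (E₀ : ℂ) • v‖ ≤ Metric.diam Γ * ‖v‖ := by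
  refine le_of_sq_le_sq ?_ (by positivity)
  rw [mul_pow, ← hH.eigenvectorBasis.sum_sq_norm_inner_right,
    ← hH.eigenvectorBasis.sum_sq_norm_inner_right v, Finset.mul_sum]
  refine Finset.sum_le_sum fun i _ => ?_
  rw [inner_eigenvectorBasis_sub_smul]
  by_cases hi : hH.eigenvalues i ∈ Γ
  · rw [norm_mul, mul_pow, Complex.norm_real]
    gcongr
    exact Metric.dist_le_diam_of_mem hs.isBounded hi hE₀
  · simp [inner_eigenvectorBasis_eq_zero hH hi hv]

/-- The gap above the sector as an operator inequality. -/
theorem IsGroundSector.gap_le_inner (hs : IsGroundSector H Γ ΔE) (hH : H.IsHermitian)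
    {E₀ : ℝ} (hE₀ : E₀ ∈ Γ) (hmin : ∀ E ∈ Γ, E₀ ≤ E) (w : EuclideanSpace ℂ ι) :
    ΔE * ‖w - (sectorSpace H Γ).starProjection w‖ ^ 2 ≤
      (inner ℂ w (Matrix.toEuclideanLin H w - (E₀ : ℂ) • w)).re := by
  rw [← hH.eigenvectorBasis.sum_inner_mul_inner, Complex.re_sum,
    ← hH.eigenvectorBasis.sum_sq_norm_inner_right, Finset.mul_sum]
  refine Finset.sum_le_sum fun i _ => ?_
  rw [inner_eigenvectorBasis_sub_smul]
  have h1 : (inner ℂ w (hH.eigenvectorBasis i) * (((hH.eigenvalues i - E₀ : ℝ) : ℂ) *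
      inner ℂ (hH.eigenvectorBasis i) w)).re =
      (hH.eigenvalues i - E₀) * ‖inner ℂ (hH.eigenvectorBasis i) w‖ ^ 2 := by
    rw [← inner_conj_symm, mul_left_comm, Complex.re_ofReal_mul, mul_comm (starRingEnd ℂ _),
      Complex.mul_conj, Complex.ofReal_re, Complex.normSq_eq_norm_sq]
  rw [h1]
  by_cases hi : hH.eigenvalues i ∈ Γ
  · have h2 : inner ℂ (hH.eigenvectorBasis i) (w - (sectorSpace H Γ).starProjection w) = 0 :=
      Submodule.inner_right_of_mem_orthogonal (eigenvectorBasis_mem_sectorSpace hH hi)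
        (Submodule.sub_starProjection_mem_orthogonal w)
    rw [h2]
    have := hmin _ hi
    simp only [norm_zero, ne_eq, OfNat.ofNat_ne_zero, not_false_eq_true, zero_pow, mul_zero]
    exact mul_nonneg (by linarith) (by positivity)
  · rw [inner_sub_right, inner_eigenvectorBasis_eq_zero hH hi
      (Submodule.starProjection_apply_mem _ w), sub_zero]
    gcongr
    have hmem : hH.eigenvalues i ∈ spectrum ℝ H \ Γ := ⟨hH.eigenvalues_mem_spectrum_real i, hi⟩
    have h3 := hs.gap _ hE₀ _ hmem
    rw [abs_of_pos (by linarith [hs.bottom _ hE₀ _ hmem])] at h3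
    exact h3.le

end SpectralSector

/-! ### From conjugation to a bound on the expectation -/

section MatrixBound

open scoped Matrix.Norms.L2Operator

variable {ι : Type*} [Fintype ι] [DecidableEq ι] {H : Matrix ι ι ℂ} {Γ : Set ℝ} {ΔE : ℝ}

theorem norm_toEuclideanLin_le (A : Matrix ι ι ℂ) (w : EuclideanSpace ℂ ι) :
    ‖Matrix.toEuclideanLin A w‖ ≤ ‖A‖ * ‖w‖ :=
  Matrix.l2_opNorm_mulVec A w

theorem toEuclideanLin_mul_apply (A B : Matrix ι ι ℂ) (w : EuclideanSpace ℂ ι) :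
    Matrix.toEuclideanLin (A * B) w = Matrix.toEuclideanLin A (Matrix.toEuclideanLin B w) := by
  simp [Matrix.toLpLin_apply, Matrix.mulVec_mulVec]

/-- If conjugation by the Hermitian matrix `g` changes the Hermitian part of `H` by a small amount
only, then the ground-state expectation of an observable `A` with `g A g⁻¹ = t A` is at most of the
order of `t`. -/
theorem norm_groundExpectation_le (hs : IsGroundSector H Γ ΔE) (hΔ : 0 < ΔE)
    (hH : H.IsHermitian) {g g' A : Matrix ι ι ℂ} (hg : g.IsHermitian) (hg' : g'.IsHermitian)
    (hgg' : g * g' = 1) (hg'g : g' * g = 1)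
    (hsmall : ‖(1 / 2 : ℂ) • (g * H * g' + g' * H * g) - H‖ + ‖g‖ * ‖g'‖ * Metric.diam Γ ≤ ΔE / 4)
    {t : ℂ} (hA : g * A * g' = t • A) :
    ‖groundExpectation H Γ A‖ ≤ 3 * ‖A‖ * ‖t‖ := by
  obtain ⟨E₀, hE₀, hmin⟩ := Set.exists_min_image Γ id
    (H.finite_real_spectrum.subset hs.subset_spectrum) hs.nonempty
  have hgl : ∀ v, Matrix.toEuclideanLin g' (Matrix.toEuclideanLin g v) = v := fun v => by
    rw [← toEuclideanLin_mul_apply, hg'g]; simp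
  have hgr : ∀ v, Matrix.toEuclideanLin g (Matrix.toEuclideanLin g' v) = v := fun v => by
    rw [← toEuclideanLin_mul_apply, hgg']; simp
  have hT : ∀ w : EuclideanSpace ℂ ι, ‖(1 / 2 : ℂ) • (Matrix.toEuclideanLin g
      (Matrix.toEuclideanLin H (Matrix.toEuclideanLin g' w)) + Matrix.toEuclideanLin g'
      (Matrix.toEuclideanLin H (Matrix.toEuclideanLin g w))) - Matrix.toEuclideanLin H w‖ ≤
      ‖(1 / 2 : ℂ) • (g * H * g' + g' * H * g) - H‖ * ‖w‖ := fun w => by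
    simp only [← toEuclideanLin_mul_apply, ← mul_assoc]
    refine le_of_eq_of_le ?_ (norm_toEuclideanLin_le _ w)
    simp only [map_sub, map_smul, map_add, LinearMap.sub_apply, LinearMap.smul_apply,
      LinearMap.add_apply]
  have key := norm_sub_starProjection_le (sectorSpace H Γ) _ _ _ (isSymmetric_toEuclideanLin hH)
    (isSymmetric_toEuclideanLin hg) (isSymmetric_toEuclideanLin hg') hgl hΔ Metric.diam_nonneg
    (norm_nonneg g) (fun v hv => hs.norm_apply_sub_le hH hE₀ hv) (hs.gap_le_inner hH hE₀ hmin)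
    (norm_toEuclideanLin_le g) (norm_toEuclideanLin_le g') hT hsmall
  have key' := norm_sub_starProjection_le (sectorSpace H Γ) _ _ _ (isSymmetric_toEuclideanLin hH)
    (isSymmetric_toEuclideanLin hg') (isSymmetric_toEuclideanLin hg) hgr hΔ Metric.diam_nonneg
    (norm_nonneg g') (fun v hv => hs.norm_apply_sub_le hH hE₀ hv) (hs.gap_le_inner hH hE₀ hmin)
    (norm_toEuclideanLin_le g') (norm_toEuclideanLin_le g)
    (fun w => by rw [add_comm]; exact hT w) (by rw [mul_comm ‖g'‖]; exact hsmall)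
  have htr := norm_trace_comp_oblique_projection_le (sectorSpace H Γ) _ _ hgl (by norm_num)
    (norm_oblique_projection_le (sectorSpace H Γ) _ _ (isSymmetric_toEuclideanLin hg') hgl hgr
      key key') (Matrix.toEuclideanLin A) (norm_toEuclideanLin_le A)
  -- `Tr (A P) = Tr (g A P g') = Tr ((g A g') (g P g')) = t Tr (A g P g')`.
  have heq : LinearMap.trace ℂ (EuclideanSpace ℂ ι)
      (Matrix.toEuclideanLin A ∘ₗ ((sectorSpace H Γ).starProjection : _ →ₗ[ℂ] _)) =
      t * LinearMap.trace ℂ (EuclideanSpace ℂ ι) (Matrix.toEuclideanLin A ∘ₗ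
        Matrix.toEuclideanLin g ∘ₗ ((sectorSpace H Γ).starProjection : _ →ₗ[ℂ] _) ∘ₗ
          Matrix.toEuclideanLin g') := by
    rw [← smul_eq_mul, ← map_smul, ← LinearMap.smul_comp, ← map_smul, ← hA]
    have h1 : Matrix.toEuclideanLin (g * A * g') ∘ₗ Matrix.toEuclideanLin g ∘ₗ
        ((sectorSpace H Γ).starProjection : _ →ₗ[ℂ] _) ∘ₗ Matrix.toEuclideanLin g' =
        (Matrix.toEuclideanLin g ∘ₗ Matrix.toEuclideanLin A ∘ₗ
          ((sectorSpace H Γ).starProjection : _ →ₗ[ℂ] _)) ∘ₗ Matrix.toEuclideanLin g' := by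
      ext1 w
      simp only [LinearMap.comp_apply, toEuclideanLin_mul_apply, hgl]
    have h2 : Matrix.toEuclideanLin g' ∘ₗ (Matrix.toEuclideanLin g ∘ₗ Matrix.toEuclideanLin A ∘ₗ
        ((sectorSpace H Γ).starProjection : EuclideanSpace ℂ ι →ₗ[ℂ] EuclideanSpace ℂ ι)) =
        Matrix.toEuclideanLin A ∘ₗ
          ((sectorSpace H Γ).starProjection : EuclideanSpace ℂ ι →ₗ[ℂ] EuclideanSpace ℂ ι) := by
      ext1 w
      simp only [LinearMap.comp_apply, hgl]
    rw [h1]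
    exact (congrArg _ h2.symm).trans (LinearMap.trace_comp_comm' _ _)
  rw [groundExpectation, heq, norm_mul, norm_mul]
  have hq : ‖1 / (Module.finrank ℂ (sectorSpace H Γ) : ℂ)‖ * Module.finrank ℂ (sectorSpace H Γ)
      ≤ 1 := by
    rw [norm_div, norm_one, Complex.norm_natCast, one_div]
    exact inv_mul_le_one
  calc _ ≤ ‖1 / (Module.finrank ℂ (sectorSpace H Γ) : ℂ)‖ * (‖t‖ *
        (3 * ‖A‖ * Module.finrank ℂ (sectorSpace H Γ))) := by gcongr
    _ = (‖1 / (Module.finrank ℂ (sectorSpace H Γ) : ℂ)‖ * Module.finrank ℂ (sectorSpace H Γ)) *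
        (3 * ‖A‖ * ‖t‖) := by ring
    _ ≤ 1 * (3 * ‖A‖ * ‖t‖) := by gcongr
    _ = _ := one_mul _

end MatrixBound

open scoped Matrix.Norms.L2Operator

/-! ### Algebra of single-site operators -/

section OnSite

variable {V : Type*} [Fintype V] [DecidableEq V] {k : ℕ}

theorem onSite_mul (i : V) (A B : Matrix (Fin (k + 1)) (Fin (k + 1)) ℂ) :
    onSite i (A * B) = onSite i A * onSite i B := by
  ext σ τ
  rw [Matrix.mul_apply]
  -- Only intermediate configurations that differ from `σ` at most at `i` contribute to the matrix
  -- product.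
  have h1 : ∀ ρ : Config V k, ρ ∉ Finset.univ.image (Function.update σ i) →
      onSite i A σ ρ * onSite i B ρ τ = 0 := by
    intro ρ hρ
    have : ¬ ∀ j, j ≠ i → σ j = ρ j := by
      intro h
      apply hρ
      refine Finset.mem_image.2 ⟨ρ i, Finset.mem_univ _, ?_⟩
      ext1 j
      by_cases hj : j = i
      · subst hj; simp
      · simp [hj, h j hj]
    simp [onSite, this]
  rw [← Finset.sum_subset (Finset.subset_univ (Finset.univ.image (Function.update σ i)))
    (fun ρ _ hρ => h1 ρ hρ), Finset.sum_image (fun a _ b _ h => Function.update_injective σ i h)]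
  have h2 : ∀ a, (∀ j, j ≠ i → σ j = Function.update σ i a j) := fun a j hj => by simp [hj]
  have h3 : ∀ a, (∀ j, j ≠ i → Function.update σ i a j = τ j) ↔ ∀ j, j ≠ i → σ j = τ j := by
    intro a
    refine forall₂_congr fun j hj => by simp [hj]
  by_cases h : ∀ j, j ≠ i → σ j = τ j
  · simp only [onSite, if_pos h, if_pos (h2 _), if_pos ((h3 _).2 h), Function.update_self,
      Matrix.mul_apply]
  · simp only [onSite, if_neg h, if_neg (fun h' => h ((h3 _).1 h')), mul_zero,
      Finset.sum_const_zero]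

/-- `onSite` as a homomorphism of star algebras. -/
def onSiteHom (i : V) : Matrix (Fin (k + 1)) (Fin (k + 1)) ℂ →⋆ₙₐ[ℂ]
    Matrix (Config V k) (Config V k) ℂ where
  toFun := onSite i
  map_smul' c A := by ext σ τ; simp [onSite]
  map_zero' := by ext σ τ; simp [onSite]
  map_add' A B := by ext σ τ; simp only [onSite, Matrix.add_apply]; split_ifs <;> simp
  map_mul' A B := onSite_mul i A B
  map_star' A := by
    ext σ τ
    have h : (∀ j, j ≠ i → τ j = σ j) ↔ (∀ j, j ≠ i → σ j = τ j) :=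
      forall₂_congr fun j _ => eq_comm
    simp only [onSite, Matrix.star_apply, h]
    split_ifs <;> simp

/-- A star homomorphism of C⋆-algebras is contractive; this makes the bound independent of the
volume. -/
theorem norm_onSite_le (i : V) (A : Matrix (Fin (k + 1)) (Fin (k + 1)) ℂ) :
    ‖onSite i A‖ ≤ ‖A‖ :=
  NonUnitalStarAlgHom.norm_apply_le (onSiteHom i) A

theorem onSite_add (i : V) (A B : Matrix (Fin (k + 1)) (Fin (k + 1)) ℂ) :
    onSite i (A + B) = onSite i A + onSite i B :=
  map_add (onSiteHom i) A B

theorem onSite_sub (i : V) (A B : Matrix (Fin (k + 1)) (Fin (k + 1)) ℂ) :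
    onSite i (A - B) = onSite i A - onSite i B :=
  map_sub (onSiteHom i) A B

theorem onSite_smul (i : V) (c : ℂ) (A : Matrix (Fin (k + 1)) (Fin (k + 1)) ℂ) :
    onSite i (c • A) = c • onSite i A :=
  map_smul (onSiteHom i) c A

theorem isHermitian_onSite (i : V) {A : Matrix (Fin (k + 1)) (Fin (k + 1)) ℂ}
    (hA : A.IsHermitian) : (onSite i A).IsHermitian := by
  have := map_star (onSiteHom i) A
  rw [Matrix.star_eq_conjTranspose, hA] at this
  exact this.symm

theorem isHermitian_spinX : (spinX k).IsHermitian := by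
  rw [Matrix.IsHermitian, spinX, spinMinus, Matrix.conjTranspose_smul, Matrix.conjTranspose_add,
    Matrix.conjTranspose_conjTranspose, add_comm (spinPlus k)]
  simp

theorem isHermitian_spinY : (spinY k).IsHermitian := by
  rw [Matrix.IsHermitian, spinY, spinMinus, Matrix.conjTranspose_smul, Matrix.conjTranspose_sub,
    Matrix.conjTranspose_conjTranspose, ← neg_sub, smul_neg, ← neg_smul]
  congr 1
  simp

theorem isHermitian_spinZ : (spinZ k).IsHermitian := by
  rw [spinZ, Matrix.isHermitian_diagonal_iff]
  intro a
  simp [IsSelfAdjoint]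

/-- The transverse coupling in terms of the raising and lowering operators. -/
theorem onSite_spinX_mul_add_spinY_mul (i j : V) :
    onSite i (spinX k) * onSite j (spinX k) + onSite i (spinY k) * onSite j (spinY k) =
      (1 / 2 : ℂ) • (onSite i (spinPlus k) * onSite j (spinMinus k) +
        onSite i (spinMinus k) * onSite j (spinPlus k)) := by
  simp only [spinX, spinY, onSite_smul, onSite_add, onSite_sub, smul_mul_smul_comm]
  have h : (1 / (2 * Complex.I) * (1 / (2 * Complex.I)) : ℂ) = -(1 / 4) := by
    field_simp
    norm_num
  rw [h]
  simp only [mul_add, add_mul, mul_sub, sub_mul]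
  module

end OnSite

/-! ### Sums over bonds -/

section BondSum

variable {V : Type*} [Fintype V] {G : SimpleGraph V}

theorem map_bondSum {M M' : Type*} [AddCommMonoid M] [Module ℂ M] [AddCommMonoid M'] [Module ℂ M']
    (T : M →ₗ[ℂ] M') (f : V → V → M) :
    T (bondSum G f) = bondSum G fun i j => T (f i j) := by
  simp only [bondSum, map_smul, map_sum, apply_ite T, map_zero]

theorem isHermitian_bondSum {ι : Type*} {f : V → V → Matrix ι ι ℂ}
    (hf : ∀ i j, (f i j).conjTranspose = f j i) : (bondSum G f).IsHermitian := by
  classical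
  rw [Matrix.IsHermitian, bondSum, Matrix.conjTranspose_smul, Matrix.conjTranspose_sum]
  congr 1
  · simp
  simp only [Matrix.conjTranspose_sum]
  rw [Finset.sum_comm]
  refine Finset.sum_congr rfl fun i _ => Finset.sum_congr rfl fun j _ => ?_
  rw [← hf j i, G.adj_comm]
  split_ifs <;> simp

open Classical in
theorem norm_bondSum_le {M : Type*} [NormedAddCommGroup M] [NormedSpace ℂ M] (f : V → V → M) :
    ‖bondSum G f‖ ≤ 1 / 2 * ∑ i, ∑ j, if G.Adj i j then ‖f i j‖ else 0 := by
  rw [bondSum, norm_smul]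
  norm_num
  refine norm_sum_le_of_le _ fun i _ => norm_sum_le_of_le _ fun j _ => ?_
  split_ifs <;> simp

end BondSum

/-! ### The imaginary-angle rotation and its action on spins -/

section Gauge

variable {V : Type*} [Fintype V] {k : ℕ}

/-- The eigenvalue of `∑ j, α j • S_j^z` on a vector of the product basis. -/
noncomputable def spinWeight (α : V → ℝ) (σ : Config V k) : ℝ :=
  ∑ j, α j * ((k : ℝ) / 2 - (σ j : ℕ))

theorem spinWeight_neg (α : V → ℝ) (σ : Config V k) : spinWeight (-α) σ = -spinWeight α σ := by
  simp [spinWeight]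

theorem abs_spinWeight_le (α : V → ℝ) (σ : Config V k) :
    |spinWeight α σ| ≤ (k : ℝ) / 2 * ∑ j, |α j| := by
  rw [Finset.mul_sum]
  refine (Finset.abs_sum_le_sum_abs _ _).trans (Finset.sum_le_sum fun j _ => ?_)
  rw [abs_mul, mul_comm]
  gcongr
  have h1 : ((σ j : ℕ) : ℝ) ≤ k := by exact_mod_cast Nat.lt_succ_iff.1 (σ j).2
  have h2 : (0 : ℝ) ≤ (σ j : ℕ) := by positivity
  rw [abs_le]
  constructor <;> linarith

/-- The complex rotation `exp (∑ j, α j • S_j^z)`. -/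
noncomputable def gauge (k : ℕ) (α : V → ℝ) : Matrix (Config V k) (Config V k) ℂ :=
  Matrix.diagonal fun σ => ((Real.exp (spinWeight α σ) : ℝ) : ℂ)

theorem isHermitian_gauge (α : V → ℝ) : (gauge k α).IsHermitian := by
  rw [gauge, Matrix.isHermitian_diagonal_iff]
  intro σ
  exact Complex.conj_ofReal _

variable [DecidableEq V]

theorem gauge_mul_gauge_neg (α : V → ℝ) : gauge k α * gauge k (-α) = 1 := by
  rw [gauge, gauge, Matrix.diagonal_mul_diagonal, ← Matrix.diagonal_one]
  congr 1
  ext1 σ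
  rw [spinWeight_neg, ← Complex.ofReal_mul, ← Real.exp_add]
  simp

theorem gauge_neg_mul_gauge (α : V → ℝ) : gauge k (-α) * gauge k α = 1 := by
  simpa using gauge_mul_gauge_neg (k := k) (-α)

theorem norm_gauge_le (α : V → ℝ) :
    ‖gauge k α‖ ≤ Real.exp ((k : ℝ) / 2 * ∑ j, |α j|) := by
  rw [gauge, Matrix.l2_opNorm_diagonal, pi_norm_le_iff_of_nonneg (Real.exp_pos _).le]
  intro σ
  rw [Complex.norm_real, Real.norm_of_nonneg (Real.exp_pos _).le]
  exact Real.exp_le_exp.2 ((le_abs_self _).trans (abs_spinWeight_le α σ))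

/-- The rotation multiplies a single-site operator that raises `S^z` by `w` by a scalar. -/
theorem gauge_mul_onSite_mul (α : V → ℝ) (i : V) {A : Matrix (Fin (k + 1)) (Fin (k + 1)) ℂ} {w : ℝ}
    (hA : ∀ a b, A a b ≠ 0 → ((b : ℕ) : ℝ) - (a : ℕ) = w) :
    gauge k α * onSite i A * gauge k (-α) = ((Real.exp (α i * w) : ℝ) : ℂ) • onSite i A := by
  ext σ τ
  rw [gauge, gauge, Matrix.mul_diagonal, Matrix.diagonal_mul, Matrix.smul_apply, smul_eq_mul,
    mul_right_comm]
  by_cases h : onSite i A σ τ = 0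
  · simp [h]
  congr 1
  rw [← Complex.ofReal_mul, ← Real.exp_add, spinWeight_neg, ← sub_eq_add_neg]
  have hoff : ∀ j, j ≠ i → σ j = τ j := by
    by_contra h'
    exact h (by simp [onSite, h'])
  have hne : A (σ i) (τ i) ≠ 0 := by
    rwa [onSite, if_pos hoff] at h
  congr 2
  rw [spinWeight, spinWeight, ← Finset.sum_sub_distrib, Finset.sum_eq_single i]
  · rw [← hA _ _ hne]; ring
  · intro j _ hj
    rw [hoff j hj, sub_self]
  · simp

theorem gauge_mul_mul (α : V → ℝ) (A B : Matrix (Config V k) (Config V k) ℂ) :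
    gauge k α * (A * B) * gauge k (-α) =
      (gauge k α * A * gauge k (-α)) * (gauge k α * B * gauge k (-α)) := by
  have h := gauge_neg_mul_gauge (k := k) α
  calc _ = gauge k α * A * 1 * B * gauge k (-α) := by simp only [mul_one, mul_assoc]
    _ = _ := by rw [← h]; simp only [mul_assoc]

theorem gauge_mul_spinPlus_mul (α : V → ℝ) (i : V) :
    gauge k α * onSite i (spinPlus k) * gauge k (-α) =
      ((Real.exp (α i) : ℝ) : ℂ) • onSite i (spinPlus k) := by
  have := gauge_mul_onSite_mul (k := k) α i (A := spinPlus k) (w := 1) (by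
    intro a b h
    simp only [spinPlus, ne_eq, ite_eq_right_iff, Classical.not_imp] at h
    rw [← h.1]; push_cast; ring)
  simpa using this

theorem gauge_mul_spinMinus_mul (α : V → ℝ) (i : V) :
    gauge k α * onSite i (spinMinus k) * gauge k (-α) =
      ((Real.exp (-α i) : ℝ) : ℂ) • onSite i (spinMinus k) := by
  have := gauge_mul_onSite_mul (k := k) α i (A := spinMinus k) (w := -1) (by
    intro a b h
    simp only [spinMinus, spinPlus, Matrix.conjTranspose_apply, ne_eq, star_eq_zero,
      ite_eq_right_iff, Classical.not_imp] at h
    rw [← h.1]; push_cast; ring)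
  simpa using this

theorem gauge_mul_spinZ_mul (α : V → ℝ) (i : V) :
    gauge k α * onSite i (spinZ k) * gauge k (-α) = onSite i (spinZ k) := by
  have := gauge_mul_onSite_mul (k := k) α i (A := spinZ k) (w := 0) (by
    intro a b h
    have : a = b := by
      by_contra hab
      exact h (by simp [spinZ, hab])
    simp [this])
  simpa using this

theorem gauge_mul_spinPlus_spinMinus_mul (α : V → ℝ) (i j : V) :
    gauge k α * (onSite i (spinPlus k) * onSite j (spinMinus k)) * gauge k (-α) =
      ((Real.exp (α i - α j) : ℝ) : ℂ) • (onSite i (spinPlus k) * onSite j (spinMinus k)) := by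
  rw [gauge_mul_mul, gauge_mul_spinPlus_mul, gauge_mul_spinMinus_mul, smul_mul_smul_comm,
    ← Complex.ofReal_mul, ← Real.exp_add, sub_eq_add_neg]

theorem gauge_mul_spinMinus_spinPlus_mul (α : V → ℝ) (i j : V) :
    gauge k α * (onSite i (spinMinus k) * onSite j (spinPlus k)) * gauge k (-α) =
      ((Real.exp (α j - α i) : ℝ) : ℂ) • (onSite i (spinMinus k) * onSite j (spinPlus k)) := by
  rw [gauge_mul_mul, gauge_mul_spinPlus_mul, gauge_mul_spinMinus_mul, smul_mul_smul_comm,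
    ← Complex.ofReal_mul, ← Real.exp_add, neg_add_eq_sub]

/-- The change of the Hermitian part of an observable under the complex rotation. -/
noncomputable def hermitianShift (k : ℕ) (α : V → ℝ) :
    Matrix (Config V k) (Config V k) ℂ →ₗ[ℂ] Matrix (Config V k) (Config V k) ℂ :=
  (1 / 2 : ℂ) • (LinearMap.mulRight ℂ (gauge k (-α)) ∘ₗ LinearMap.mulLeft ℂ (gauge k α) +
    LinearMap.mulRight ℂ (gauge k α) ∘ₗ LinearMap.mulLeft ℂ (gauge k (-α))) - LinearMap.id

theorem hermitianShift_apply (α : V → ℝ) (M : Matrix (Config V k) (Config V k) ℂ) :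
    hermitianShift k α M =
      (1 / 2 : ℂ) • (gauge k α * M * gauge k (-α) + gauge k (-α) * M * gauge k α) - M := rfl

/-- The raising-lowering terms acquire the factors `exp (±(α i - α j))`. Averaging over `α` and `-α`
turns each into `cosh` and cancels the first-order `sinh`. -/
theorem hermitianShift_transverse (α : V → ℝ) (i j : V) :
    hermitianShift k α
      (onSite i (spinX k) * onSite j (spinX k) + onSite i (spinY k) * onSite j (spinY k)) =
      ((Real.cosh (α i - α j) - 1 : ℝ) : ℂ) •
      (onSite i (spinX k) * onSite j (spinX k) + onSite i (spinY k) * onSite j (spinY k)) := by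
  have h1 := gauge_mul_spinPlus_spinMinus_mul (k := k) α i j
  have h2 := gauge_mul_spinPlus_spinMinus_mul (k := k) (-α) i j
  have h3 := gauge_mul_spinMinus_spinPlus_mul (k := k) α i j
  have h4 := gauge_mul_spinMinus_spinPlus_mul (k := k) (-α) i j
  rw [neg_neg, Pi.neg_apply, Pi.neg_apply, neg_sub_neg] at h2 h4
  rw [onSite_spinX_mul_add_spinY_mul, map_smul, map_add, hermitianShift_apply,
    hermitianShift_apply, h1, h2, h3, h4, Real.cosh_eq, neg_sub]
  push_cast
  module

theorem hermitianShift_longitudinal (α : V → ℝ) (i j : V) :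
    hermitianShift k α (onSite i (spinZ k) * onSite j (spinZ k)) = 0 := by
  have h := gauge_mul_mul (k := k) (-α) (onSite i (spinZ k)) (onSite j (spinZ k))
  have hi := gauge_mul_spinZ_mul (k := k) (-α) i
  have hj := gauge_mul_spinZ_mul (k := k) (-α) j
  rw [neg_neg] at h hi hj
  rw [hermitianShift_apply, gauge_mul_mul, h, hi, hj, gauge_mul_spinZ_mul, gauge_mul_spinZ_mul]
  module

end Gauge

/-! ### Second-order change of the Hamiltonian -/

section Hamiltonian

variable {V : Type*} [Fintype V] [DecidableEq V] {k : ℕ}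

theorem isHermitian_hamiltonian (G : SimpleGraph V) (JXY JZ : Sym2 V → ℝ) :
    (hamiltonian k G JXY JZ).IsHermitian := by
  have hreal : ∀ (c : ℝ) (M : Matrix (Config V k) (Config V k) ℂ),
      ((c : ℂ) • M).conjTranspose = (c : ℂ) • M.conjTranspose := fun c M => by
    rw [Matrix.conjTranspose_smul]
    congr 1
    exact Complex.conj_ofReal c
  refine Matrix.IsHermitian.add ?_ (isHermitian_bondSum fun i j => ?_)
  · rw [hamiltonianXY, Matrix.IsHermitian, Matrix.conjTranspose_smul, isHermitian_bondSum]
    · simp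
    intro i j
    rw [hreal, Matrix.conjTranspose_add, Matrix.conjTranspose_mul, Matrix.conjTranspose_mul,
      isHermitian_onSite _ isHermitian_spinX, isHermitian_onSite _ isHermitian_spinX,
      isHermitian_onSite _ isHermitian_spinY, isHermitian_onSite _ isHermitian_spinY, Sym2.eq_swap]
  · rw [hreal, Matrix.conjTranspose_mul, isHermitian_onSite _ isHermitian_spinZ,
      isHermitian_onSite _ isHermitian_spinZ, Sym2.eq_swap]

open Classical in
/-- The Hermitian part of the rotated Hamiltonian changes only in the second order of the
differences of the rotation angles. -/
theorem norm_hermitianShift_hamiltonian_le (G : SimpleGraph V) (JXY JZ : Sym2 V → ℝ) {J : ℝ}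
    (hJ : ∀ b ∈ G.edgeSet, |JXY b| ≤ J) (α : V → ℝ) :
    ‖hermitianShift k α (hamiltonian k G JXY JZ)‖ ≤
      J * (‖spinX k‖ ^ 2 + ‖spinY k‖ ^ 2) *
        ∑ i, ∑ j, if G.Adj i j then (Real.cosh (α i - α j) - 1) else 0 := by
  rw [hamiltonian, map_add, hamiltonianXY, potentialZ, map_smul, map_bondSum, map_bondSum]
  simp only [map_smul, hermitianShift_transverse, hermitianShift_longitudinal, smul_zero]
  have h0 : bondSum G (fun _ _ => (0 : Matrix (Config V k) (Config V k) ℂ)) = 0 := by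
    simp [bondSum]
  rw [h0, add_zero, norm_smul]
  have h1 := norm_bondSum_le (G := G) fun i j => ((JXY s(i, j) : ℝ) : ℂ) •
    ((Real.cosh (α i - α j) - 1 : ℝ) : ℂ) •
      (onSite i (spinX k) * onSite j (spinX k) + onSite i (spinY k) * onSite j (spinY k))
  have h2 : ∀ i j, G.Adj i j → ‖((JXY s(i, j) : ℝ) : ℂ) • ((Real.cosh (α i - α j) - 1 : ℝ) : ℂ) •
      (onSite i (spinX k) * onSite j (spinX k) + onSite i (spinY k) * onSite j (spinY k))‖ ≤
      J * (‖spinX k‖ ^ 2 + ‖spinY k‖ ^ 2) * (Real.cosh (α i - α j) - 1) := by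
    intro i j hij
    have hc : 0 ≤ Real.cosh (α i - α j) - 1 := sub_nonneg.2 (Real.one_le_cosh _)
    have hb := hJ s(i, j) hij
    have hJ0 : 0 ≤ J := (abs_nonneg _).trans hb
    rw [norm_smul, norm_smul, Complex.norm_real, Complex.norm_real, Real.norm_of_nonneg hc,
      Real.norm_eq_abs]
    have h3 : ‖onSite i (spinX k) * onSite j (spinX k) + onSite i (spinY k) * onSite j (spinY k)‖ ≤
        ‖spinX k‖ ^ 2 + ‖spinY k‖ ^ 2 := by
      rw [sq, sq]
      refine (norm_add_le _ _).trans (add_le_add ?_ ?_) <;>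
      · refine (norm_mul_le _ _).trans ?_
        gcongr <;> exact norm_onSite_le _ _
    calc _ ≤ J * ((Real.cosh (α i - α j) - 1) * (‖spinX k‖ ^ 2 + ‖spinY k‖ ^ 2)) := by gcongr
      _ = _ := by ring
  refine (mul_le_mul_of_nonneg_left h1 (norm_nonneg _)).trans ?_
  rw [← mul_assoc, Finset.mul_sum, Finset.mul_sum]
  refine Finset.sum_le_sum fun i _ => ?_
  rw [Finset.mul_sum, Finset.mul_sum]
  refine Finset.sum_le_sum fun j _ => ?_
  split_ifs with h
  · have := h2 i j h
    norm_num at this ⊢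
    linarith
  · simp

end Hamiltonian

/-! ### The cone of angles and volume growth -/

section Cone

variable {V : Type*} {G : SimpleGraph V}

/-- The function of slope `η` that decreases from `η r` at `m` to zero at the distance `r`. -/
noncomputable def cone (G : SimpleGraph V) (m : V) (r : ℕ) (η : ℝ) (j : V) : ℝ :=
  η * ((r : ℝ) - (min (G.dist j m) r : ℕ))

theorem cone_self (m : V) (r : ℕ) (η : ℝ) : cone G m r η m = η * r := by
  simp [cone]

theorem cone_of_le {m j : V} {r : ℕ} (η : ℝ) (h : r ≤ G.dist j m) : cone G m r η j = 0 := by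
  simp [cone, min_eq_right h]

theorem abs_cone_le (m j : V) (r : ℕ) {η : ℝ} (hη : 0 ≤ η) : |cone G m r η j| ≤ η * r := by
  have h1 : ((min (G.dist j m) r : ℕ) : ℝ) ≤ r := by exact_mod_cast min_le_right _ _
  have h2 : (0 : ℝ) ≤ ((min (G.dist j m) r : ℕ) : ℝ) := Nat.cast_nonneg _
  rw [cone, abs_mul, abs_of_nonneg hη]
  gcongr
  rw [abs_of_nonneg (by linarith)]
  linarith

theorem abs_cone_sub_cone_le (hG : G.Connected) (m : V) (r : ℕ) {η : ℝ} (hη : 0 ≤ η) {i j : V}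
    (h : G.Adj i j) : |cone G m r η i - cone G m r η j| ≤ η := by
  have h1 := hG.dist_triangle (u := i) (v := j) (w := m)
  have h2 := hG.dist_triangle (u := j) (v := i) (w := m)
  rw [SimpleGraph.dist_eq_one_iff_adj.2 h] at h1
  rw [SimpleGraph.dist_eq_one_iff_adj.2 h.symm] at h2
  have h3 : ((min (G.dist i m) r : ℕ) : ℝ) ≤ (min (G.dist j m) r : ℕ) + 1 := by
    exact_mod_cast (by omega : min (G.dist i m) r ≤ min (G.dist j m) r + 1)
  have h4 : ((min (G.dist j m) r : ℕ) : ℝ) ≤ (min (G.dist i m) r : ℕ) + 1 := by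
    exact_mod_cast (by omega : min (G.dist j m) r ≤ min (G.dist i m) r + 1)
  rw [cone, cone, ← mul_sub, abs_mul, abs_of_nonneg hη]
  refine mul_le_of_le_one_right hη (abs_le.2 ⟨?_, ?_⟩) <;> linarith

variable [Fintype V] {D C₀ : ℝ}

open Classical in
theorem SphereBound.card_neighbors_le (hS : SphereBound G D C₀) (i : V) :
    ((Finset.univ.filter fun j => G.Adj i j).card : ℝ) ≤ C₀ := by
  have h := hS i 1 le_rfl
  rw [Nat.cast_one, Real.one_rpow, mul_one] at h
  convert h
  rw [← Set.ncard_coe_finset]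
  congr 1
  ext j
  simp [SimpleGraph.dist_eq_one_iff_adj, G.adj_comm]

-- The ball is its centre and `r` spheres, each of at most `C₀ r^(D-1)` sites because `D ≥ 1`.
open Classical in
theorem SphereBound.card_ball_le (hS : SphereBound G D C₀) (hG : G.Connected) (hD : 1 ≤ D)
    (hC₀ : 0 ≤ C₀) (m : V) {r : ℕ} (hr : 1 ≤ r) :
    ((Finset.univ.filter fun j => G.dist j m ≤ r).card : ℝ) ≤ (1 + C₀) * (r : ℝ) ^ D := by
  have hr' : (1 : ℝ) ≤ r := by exact_mod_cast hr
  have hsub : (Finset.univ.filter fun j => G.dist j m ≤ r) ⊆ insert m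
      ((Finset.Icc 1 r).biUnion fun s => Finset.univ.filter fun j => G.dist j m = s) := by
    intro j hj
    simp only [Finset.mem_filter, Finset.mem_univ, true_and] at hj
    simp only [Finset.mem_insert, Finset.mem_biUnion, Finset.mem_Icc, Finset.mem_filter,
      Finset.mem_univ, true_and, exists_eq_right']
    rcases Nat.eq_zero_or_pos (G.dist j m) with h | h
    · exact Or.inl (hG.dist_eq_zero_iff.1 h)
    · exact Or.inr ⟨h, hj⟩
  have hcard : (Finset.univ.filter fun j => G.dist j m ≤ r).card ≤
      (∑ s ∈ Finset.Icc 1 r, (Finset.univ.filter fun j => G.dist j m = s).card) + 1 :=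
    (Finset.card_le_card hsub).trans ((Finset.card_insert_le _ _).trans
      (Nat.add_le_add_right Finset.card_biUnion_le 1))
  have hsph : ∀ s ∈ Finset.Icc 1 r,
      ((Finset.univ.filter fun j => G.dist j m = s).card : ℝ) ≤ C₀ * (r : ℝ) ^ (D - 1) := by
    intro s hs
    rw [Finset.mem_Icc] at hs
    have h := hS m s hs.1
    have h1 : Set.ncard {l : V | G.dist l m = s} =
        (Finset.univ.filter fun j => G.dist j m = s).card := by
      rw [← Set.ncard_coe_finset]
      simp
    rw [h1] at h
    refine h.trans ?_
    gcongr
    linarith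
  calc ((Finset.univ.filter fun j => G.dist j m ≤ r).card : ℝ)
      ≤ (∑ s ∈ Finset.Icc 1 r, ((Finset.univ.filter fun j => G.dist j m = s).card : ℝ)) + 1 := by
        exact_mod_cast hcard
    _ ≤ (∑ _s ∈ Finset.Icc 1 r, C₀ * (r : ℝ) ^ (D - 1)) + 1 := by
        gcongr with s hs
        exact hsph s hs
    _ = C₀ * (r : ℝ) ^ D + 1 := by
        rw [Finset.sum_const, Nat.card_Icc, nsmul_eq_mul, Real.rpow_sub_one (by positivity)]
        simp only [Nat.add_sub_cancel]
        field_simp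
    _ ≤ _ := by
        have := Real.one_le_rpow hr' (by linarith : 0 ≤ D)
        linarith

/-- Combines `cosh x ≤ exp (x²/2)` with `|exp y - 1| ≤ 2 |y|` for `|y| ≤ 1`. -/
theorem cosh_sub_one_le {x η : ℝ} (hx : |x| ≤ η) (hη : η ≤ 1) : Real.cosh x - 1 ≤ η ^ 2 := by
  have h0 : x ^ 2 ≤ η ^ 2 := by rw [← sq_abs]; gcongr
  have h1 : x ^ 2 ≤ 1 := by nlinarith [abs_nonneg x]
  have h2 := Real.cosh_le_exp_half_sq x
  have h3 := (abs_le.1 (Real.abs_exp_sub_one_le (x := x ^ 2 / 2)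
    (by rw [abs_of_nonneg (by positivity)]; linarith))).2
  rw [abs_of_nonneg (by positivity)] at h3
  linarith

open Classical in
theorem SphereBound.sum_cosh_cone_le (hS : SphereBound G D C₀) (hG : G.Connected) (hD : 1 ≤ D)
    (hC₀ : 0 ≤ C₀) (m : V) (r : ℕ) {η : ℝ} (hη : 0 ≤ η) (hη1 : η ≤ 1) :
    (∑ i, ∑ j, if G.Adj i j then (Real.cosh (cone G m r η i - cone G m r η j) - 1) else 0) ≤
      C₀ * (1 + C₀) * ((r : ℝ) ^ D * η ^ 2) := by
  rcases Nat.eq_zero_or_pos r with rfl | hr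
  · simp only [cone_of_le η (Nat.zero_le _), Real.cosh_zero, sub_self, ite_self,
      Finset.sum_const_zero]
    positivity
  have h1 : ∀ i, (∑ j, if G.Adj i j then
      (Real.cosh (cone G m r η i - cone G m r η j) - 1) else 0) ≤
      if G.dist i m ≤ r then C₀ * η ^ 2 else 0 := by
    intro i
    split_ifs with hi
    · rw [← Finset.sum_filter]
      refine (Finset.sum_le_card_nsmul _ _ (η ^ 2) fun j hj => ?_).trans ?_
      · exact cosh_sub_one_le (abs_cone_sub_cone_le hG m r hη (Finset.mem_filter.1 hj).2) hη1
      · rw [nsmul_eq_mul]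
        gcongr
        exact hS.card_neighbors_le i
    · refine (Finset.sum_eq_zero fun j _ => ?_).le
      split_ifs with hij
      · have h2 := hG.dist_triangle (u := i) (v := j) (w := m)
        rw [SimpleGraph.dist_eq_one_iff_adj.2 hij] at h2
        rw [cone_of_le η (by omega : r ≤ G.dist i m), cone_of_le η (by omega : r ≤ G.dist j m)]
        simp
      · rfl
  refine (Finset.sum_le_sum fun i _ => h1 i).trans ?_
  rw [← Finset.sum_filter, Finset.sum_const, nsmul_eq_mul]
  calc _ ≤ (1 + C₀) * (r : ℝ) ^ D * (C₀ * η ^ 2) := by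
        gcongr
        exact hS.card_ball_le hG hD hC₀ m hr
    _ = _ := by ring

-- A crude bound suffices: it only controls `‖g‖ ‖g⁻¹‖`, which multiplies the energy spread, so what
-- matters is independence of the volume.
open Classical in
theorem SphereBound.sum_abs_cone_le (hS : SphereBound G D C₀) (hG : G.Connected) (hD : 1 ≤ D)
    (hC₀ : 0 ≤ C₀) (m : V) (r : ℕ) {η : ℝ} (hη : 0 ≤ η) (hη1 : η ≤ 1) :
    (∑ j, |cone G m r η j|) ≤ (1 + C₀) * (r : ℝ) ^ D * r := by
  rcases Nat.eq_zero_or_pos r with rfl | hr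
  · simp [cone_of_le]
  have h1 : ∀ j, |cone G m r η j| ≤ if G.dist j m ≤ r then (r : ℝ) else 0 := by
    intro j
    split_ifs with hj
    · refine (abs_cone_le m j r hη).trans (mul_le_of_le_one_left (by positivity) hη1)
    · rw [cone_of_le η (by omega), abs_zero]
  refine (Finset.sum_le_sum fun j _ => h1 j).trans ?_
  rw [← Finset.sum_filter, Finset.sum_const, nsmul_eq_mul]
  gcongr
  exact hS.card_ball_le hG hD hC₀ m hr

end Cone

/-! ### Decay of the transverse correlation -/

section Correlation

open scoped Matrix.Norms.L2Operator

variable {V : Type*} [Fintype V] [DecidableEq V] {G : SimpleGraph V} {D C₀ : ℝ}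

/-- The decay of the transverse correlation in a finite volume, for a slope `κ` of the rotation
angles and an energy spread of the sector that are small compared with the gap. -/
theorem norm_transverse_correlation_le {k : ℕ} {JXY JZ : Sym2 V → ℝ} {J ΔE κ : ℝ} {Γ : Set ℝ}
    (hS : SphereBound G D C₀) (hG : G.Connected) (hD : 1 ≤ D) (hD2 : D < 2) (hC₀ : 0 ≤ C₀)
    (hJ0 : 0 ≤ J) (hJ : ∀ b ∈ G.edgeSet, |JXY b| ≤ J) (hΔ : 0 < ΔE)
    (hs : IsGroundSector (hamiltonian k G JXY JZ) Γ ΔE) (hκ : 0 ≤ κ) (hκ1 : κ ≤ 1)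
    (hκ2 : J * (‖spinX k‖ ^ 2 + ‖spinY k‖ ^ 2) * (C₀ * (1 + C₀) * κ ^ 2) ≤ ΔE / 8)
    {R : ℕ} (hdiam : Real.exp ((k : ℝ) * ((1 + C₀) * (R : ℝ) ^ D * R)) * Metric.diam Γ ≤ ΔE / 8)
    {m n : V} (hR : G.dist m n ≤ R) :
    ‖groundExpectation (hamiltonian k G JXY JZ) Γ
        (onSite m (spinPlus k) * onSite n (spinMinus k))‖ ≤
      3 * (‖spinPlus k‖ * ‖spinMinus k‖) * Real.exp (-κ * (G.dist m n : ℝ) ^ (1 - D / 2)) := by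
  set r := G.dist m n with hr
  -- This slope keeps `r^D η²` bounded by `κ²` while the total drop `η r` is `κ r^(1-D/2)`. For `r =
  -- 0` the convention `0 ^ x = 0` for `x ≠ 0` gives `η = 0`.
  set η : ℝ := κ * (r : ℝ) ^ (-(D / 2)) with hη
  have hη0 : 0 ≤ η := by positivity
  have hη1 : η ≤ 1 := by
    refine mul_le_one₀ hκ1 (by positivity) ?_
    rcases Nat.eq_zero_or_pos r with h | h
    · rw [h, Nat.cast_zero, Real.zero_rpow (by linarith)]
      exact zero_le_one
    · exact Real.rpow_le_one_of_one_le_of_nonpos (by exact_mod_cast h) (by linarith)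
  have hη2 : (r : ℝ) ^ D * η ^ 2 ≤ κ ^ 2 := by
    rcases Nat.eq_zero_or_pos r with h | h
    · rw [h, Nat.cast_zero, Real.zero_rpow (by linarith), zero_mul]
      positivity
    · have h' : (0 : ℝ) < r := by exact_mod_cast h
      rw [hη, mul_pow, ← Real.rpow_mul_natCast h'.le, mul_left_comm, ← Real.rpow_add h']
      norm_num
  have hη3 : η * r = κ * (r : ℝ) ^ (1 - D / 2) := by
    rcases Nat.eq_zero_or_pos r with h | h
    · rw [h, Nat.cast_zero, Real.zero_rpow (by linarith), mul_zero, mul_zero]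
    · have h' : (0 : ℝ) < r := by exact_mod_cast h
      rw [hη, mul_assoc, ← Real.rpow_add_one h'.ne', neg_add_eq_sub]
  set α := cone G n r η with hα
  have hαmn : α m - α n = -κ * (r : ℝ) ^ (1 - D / 2) := by
    rw [hα, cone_of_le η (le_refl r), cone_self, hη3]
    ring
  have hsum : ∑ j, |α j| ≤ (1 + C₀) * (R : ℝ) ^ D * R := by
    refine (hS.sum_abs_cone_le hG hD hC₀ n r hη0 hη1).trans ?_
    have hrR : (r : ℝ) ≤ R := by exact_mod_cast hR
    gcongr
  have hshift : ‖hermitianShift k α (hamiltonian k G JXY JZ)‖ ≤ ΔE / 8 := by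
    refine (norm_hermitianShift_hamiltonian_le G JXY JZ hJ α).trans (le_trans ?_ hκ2)
    gcongr
    refine (hS.sum_cosh_cone_le hG hD hC₀ n r hη0 hη1).trans ?_
    gcongr
  have hnorm : ‖gauge k α‖ * ‖gauge k (-α)‖ ≤
      Real.exp ((k : ℝ) * ((1 + C₀) * (R : ℝ) ^ D * R)) := by
    have h1 := norm_gauge_le (k := k) α
    have h2 := norm_gauge_le (k := k) (-α)
    simp only [Pi.neg_apply, abs_neg] at h2
    refine (mul_le_mul h1 h2 (norm_nonneg _) (Real.exp_pos _).le).trans ?_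
    rw [← Real.exp_add, ← add_mul, add_halves]
    gcongr
  -- The allowance `ΔE / 4` is split evenly between the shift of the Hamiltonian and the energy
  -- spread.
  have hsmall : ‖(1 / 2 : ℂ) • (gauge k α * hamiltonian k G JXY JZ * gauge k (-α) +
      gauge k (-α) * hamiltonian k G JXY JZ * gauge k α) - hamiltonian k G JXY JZ‖ +
      ‖gauge k α‖ * ‖gauge k (-α)‖ * Metric.diam Γ ≤ ΔE / 4 := by
    rw [← hermitianShift_apply]
    have h1 : ‖gauge k α‖ * ‖gauge k (-α)‖ * Metric.diam Γ ≤ ΔE / 8 :=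
      (mul_le_mul_of_nonneg_right hnorm Metric.diam_nonneg).trans hdiam
    linarith
  refine (norm_groundExpectation_le hs hΔ (isHermitian_hamiltonian G JXY JZ) (isHermitian_gauge α)
    (isHermitian_gauge (-α)) (gauge_mul_gauge_neg α) (gauge_neg_mul_gauge α) hsmall
    (gauge_mul_spinPlus_spinMinus_mul α m n)).trans ?_
  rw [Complex.norm_real, Real.norm_of_nonneg (Real.exp_pos _).le, hαmn]
  gcongr
  refine (norm_mul_le _ _).trans ?_
  gcongr <;> exact norm_onSite_le _ _

/-- The decay of the transverse correlation with constants that do not depend on the lattice, for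
pairs of sites whose distance is bounded in terms of the energy spread of the sector. -/
theorem exists_uniform_transverse_decay (k : ℕ) {J ΔE : ℝ} (hD : 1 ≤ D) (hD2 : D < 2)
    (hC₀ : 0 ≤ C₀) (hJ0 : 0 ≤ J) (hΔ : 0 < ΔE) :
    ∃ γ : ℝ, 0 < γ ∧ ∃ C : ℝ, 0 < C ∧ ∀ {V : Type*} [Fintype V] [DecidableEq V]
      (G : SimpleGraph V) (JXY JZ : Sym2 V → ℝ) (Γ : Set ℝ) (R : ℕ),
      SphereBound G D C₀ → G.Connected → (∀ b ∈ G.edgeSet, |JXY b| ≤ J) →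
      IsGroundSector (hamiltonian k G JXY JZ) Γ ΔE →
      Real.exp ((k : ℝ) * ((1 + C₀) * (R : ℝ) ^ D * R)) * Metric.diam Γ ≤ ΔE / 8 →
      ∀ m n : V, G.dist m n ≤ R →
        ‖groundExpectation (hamiltonian k G JXY JZ) Γ
            (onSite m (spinPlus k) * onSite n (spinMinus k))‖ ≤
          C * Real.exp (-γ * (G.dist m n : ℝ) ^ (1 - D / 2)) := by
  obtain ⟨κ, hκ0, hκ1, hκ2⟩ : ∃ κ : ℝ, 0 < κ ∧ κ ≤ 1 ∧
      J * (‖spinX k‖ ^ 2 + ‖spinY k‖ ^ 2) * (C₀ * (1 + C₀) * κ ^ 2) ≤ ΔE / 8 := by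
    set K := J * (‖spinX k‖ ^ 2 + ‖spinY k‖ ^ 2) * (C₀ * (1 + C₀)) with hK
    have hK0 : 0 ≤ K := by positivity
    -- As `κ ≤ 1`, `K κ² ≤ K κ ≤ (K + 1) κ ≤ ΔE / 8`; the `+ 1` avoids dividing by a vanishing `K`.
    have h0 : 0 < min 1 (ΔE / 8 / (K + 1)) := by positivity
    refine ⟨_, h0, min_le_left _ _, ?_⟩
    set κ := min 1 (ΔE / 8 / (K + 1))
    have h1 : κ ≤ 1 := min_le_left _ _
    have h2 : κ * (K + 1) ≤ ΔE / 8 := (le_div_iff₀ (by positivity)).1 (min_le_right _ _)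
    rw [← mul_assoc, ← hK]
    nlinarith [mul_nonneg hK0 h0.le]
  refine ⟨κ, hκ0, 3 * (‖spinPlus k‖ * ‖spinMinus k‖) + 1, by positivity, ?_⟩
  intro V _ _ G JXY JZ Γ R hS hG hJ hs hdiam m n hmn
  refine (norm_transverse_correlation_le hS hG hD hD2 hC₀ hJ0 hJ hΔ hs hκ0.le hκ1 hκ2 hdiam
    hmn).trans ?_
  gcongr
  linarith

end Correlation

end XXZ

/-! ### The thermodynamic limit -/

theorem theorem1
    -- the spin `S = k / 2`, the dimension, and the volume-independent constants
    (k : ℕ) (hk : 1 ≤ k) (D C₀ JXYmax JZmax ΔE : ℝ) (hD1 : 1 ≤ D) (hD2 : D < 2)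
    (hC₀ : 0 < C₀) (hJXYmax : 0 < JXYmax) (hJZmax : 0 < JZmax)
    -- a sequence of finite connected lattices whose volume tends to infinity
    (V : ℕ → Type*) [∀ N, Fintype (V N)] [∀ N, DecidableEq (V N)]
    (G : ∀ N, SimpleGraph (V N)) (hconn : ∀ N, (G N).Connected)
    (hvol : Tendsto (fun N => Fintype.card (V N)) atTop atTop)
    (hdim : ∀ N, XXZ.SphereBound (G N) D C₀)
    -- bounded real couplings on the bonds
    (JXY JZ : ∀ N, Sym2 (V N) → ℝ)
    (hJXY : ∀ N, ∀ b ∈ (G N).edgeSet, |JXY N b| ≤ JXYmax)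
    (hJZ : ∀ N, ∀ b ∈ (G N).edgeSet, |JZ N b| ≤ JZmax)
    -- a uniform gap above the sectors `Γ N` of the ground state
    (Γ : ℕ → Set ℝ)
    (hgap : XXZ.HasUniformGap (fun N => XXZ.hamiltonian k (G N) (JXY N) (JZ N)) Γ ΔE) :
    ∃ γ : ℝ, 0 < γ ∧ ∃ C : ℝ, 0 < C ∧
      ∀ R : ℕ, ∀ᶠ N in atTop, ∀ m n : V N, (G N).dist m n ≤ R →
        ‖XXZ.groundExpectation (XXZ.hamiltonian k (G N) (JXY N) (JZ N)) (Γ N)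
            (XXZ.onSite m (XXZ.spinPlus k) * XXZ.onSite n (XXZ.spinMinus k))‖
          ≤ C * Real.exp (-γ * (((G N).dist m n : ℕ) : ℝ) ^ (1 - D / 2)) := by
  obtain ⟨γ, hγ, C, hC, hdecay⟩ := XXZ.exists_uniform_transverse_decay k hD1 hD2 hC₀.le
    hJXYmax.le hgap.pos
  refine ⟨γ, hγ, C, hC, fun R => ?_⟩
  -- For fixed `R` the bound on `‖g‖ ‖g⁻¹‖` does not depend on `N`, so its product with the spread
  -- tends to zero. Only the threshold on `N` depends on `R`; `γ` and `C` do not.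
  have hlim := hgap.spread.const_mul (Real.exp ((k : ℝ) * ((1 + C₀) * (R : ℝ) ^ D * R)))
  rw [mul_zero] at hlim
  have hpos : 0 < ΔE / 8 := div_pos hgap.pos (by norm_num)
  filter_upwards [hlim.eventually_le_const hpos] with N hN
  exact hdecay (G N) (JXY N) (JZ N) (Γ N) R (hdim N) (hconn N) (hJXY N) (hgap.sector N) hN
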